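/- Let $d,r\in\mathbb{N}$ with $r>d/2$ and let $P$ be a Borel probability measure on $\mathbb{R}^d$. For an integer $k\ge 0$ let $W_2^k=\{f\in L_2(\mathbb{R}^d): D^\alpha f\in L_2(\mathbb{R}^d)\text{ exists for all }|\alpha|\le k\}$ (weak derivatives), with norm $\|f\|_{W_2^k}=\big(\sum_{|\alpha|\le k}\|D^\alpha f\|_{L_2}^2\big)^{1/2}$, and let $C_0^k$ be the set of real functions on $\mathbb{R}^d$ that are continuously differentiable up to order $k$ and vanish at infinity. Since $r>d/2$, $W_2^r$ is a reproducing kernel Hilbert space, its elements being identified with their continuous representatives. For each $n\ge 1$ let $X_1^{(n)},\dots,X_n^{(n)}\in\mathbb{R}^d$ be (deterministic) points and $w_1^{(n)},\dots,w_n^{(n)}\in\mathbb{R}$ arbitrary weights, and write $P_nf=\sum_{i=1}^n w_i^{(n)}f(X_i^{(n)})$, $Pf=\int f\,dP$. Let $b>0$ and suppose that (i) the worst-case error $e_n(P;W_2^r)=\sup\{|Pg-P_ng| : g\in W_2^r,\ \|g\|_{W_2^r}\le 1\}$ satisfies $e_n(P;W_2^r)=O(n^{-b})$ as $n\to\infty$;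 (ii) there is $C>0$ such that the separation radius $q_n=\min_{i\ne j}\|X_i^{(n)}-X_j^{(n)}\|$ satisfies $q_n\ge C\,n^{-b/r}$ for all $n\ge 1$ (an empty minimum being $+\infty$); (iii) $\operatorname{diam}\{X_1^{(n)},\dots,X_n^{(n)}\}\le 1$ for all $n\ge 1$. Then for every integer $0\le s\le r$ and every $f\in C_0^s\cap W_2^s$, $$|P_nf-Pf|=O\big(n^{-bs/r}\big)\qquad(n\to\infty).$$ -/

import Mathlib

open MeasureTheory Filter Topology Asymptotics
open scoped ENNReal ContDiff

noncomputable section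

/-- The `i`-th classical partial derivative of a real function on `ℝ^d`. -/
def partialDeriv {d : ℕ} (i : Fin d) (φ : EuclideanSpace ℝ (Fin d) → ℝ) :
    EuclideanSpace ℝ (Fin d) → ℝ :=
  fun x => fderiv ℝ φ x (EuclideanSpace.single i 1)

/-- The classical mixed derivative `∂₀^{α₀} ⋯ ∂_{d-1}^{α_{d-1}} φ` for a multi-index `α`. -/
def multiDeriv {d : ℕ} (α : Fin d → ℕ) (φ : EuclideanSpace ℝ (Fin d) → ℝ) :
    EuclideanSpace ℝ (Fin d) → ℝ :=
  (List.finRange d).foldr (fun i g => (partialDeriv i)^[α i] g) φ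

/-- `g` is an `α`-th weak derivative of `f` on `ℝ^d`. -/
def HasWeakDeriv {d : ℕ} (α : Fin d → ℕ) (f g : EuclideanSpace ℝ (Fin d) → ℝ) : Prop :=
  LocallyIntegrable f volume ∧ LocallyIntegrable g volume ∧
    ∀ φ : EuclideanSpace ℝ (Fin d) → ℝ, ContDiff ℝ ∞ φ → HasCompactSupport φ →
      ∫ x, f x * multiDeriv α φ x = (-1 : ℝ) ^ (∑ i, α i) * ∫ x, g x * φ x

open Classical in
/-- The `α`-th weak derivative of `f`: it is unique up to equality almost everywhere, and one
representative is chosen (the zero function is returned if there is no weak derivative). -/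
def weakDeriv {d : ℕ} (α : Fin d → ℕ) (f : EuclideanSpace ℝ (Fin d) → ℝ) :
    EuclideanSpace ℝ (Fin d) → ℝ :=
  if h : ∃ g, HasWeakDeriv α f g then h.choose else 0

/-- The finite set of multi-indices `α ∈ ℕ^d` with `|α| ≤ r`. -/
def multiIndices (d r : ℕ) : Finset (Fin d → ℕ) :=
  (Fintype.piFinset fun _ => Finset.range (r + 1)).filter fun α => ∑ i, α i ≤ r

/-- Membership of a function in the Sobolev space `W_2^r(ℝ^d)`: the function is in `L_2`, and for
every `|α| ≤ r` the weak derivative `D^α f` exists and is in `L_2`. -/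
def MemW2 {d : ℕ} (r : ℕ) (f : EuclideanSpace ℝ (Fin d) → ℝ) : Prop :=
  MemLp f 2 volume ∧
    ∀ α ∈ multiIndices d r, ∃ g, HasWeakDeriv α f g ∧ MemLp g 2 volume

/-- The Sobolev norm `(∑_{|α| ≤ r} ‖D^α f‖_{L_2}^2)^{1/2}` of `f ∈ W_2^r(ℝ^d)`. -/
def normW2 {d : ℕ} (r : ℕ) (f : EuclideanSpace ℝ (Fin d) → ℝ) : ℝ :=
  Real.sqrt (∑ α ∈ multiIndices d r, (eLpNorm (weakDeriv α f) 2 volume).toReal ^ 2)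

/-- Membership in `C_0^s(ℝ^d)`: continuously differentiable up to order `s` and vanishing at
infinity. -/
def MemC0 {d : ℕ} (s : ℕ) (f : EuclideanSpace ℝ (Fin d) → ℝ) : Prop :=
  ContDiff ℝ s f ∧ Tendsto f (cocompact (EuclideanSpace ℝ (Fin d))) (𝓝 0)

/-- The quadrature sum `P_n f = ∑ i, w i * f (X i)`. -/
def quadSum {d n : ℕ} (w : Fin n → ℝ) (X : Fin n → EuclideanSpace ℝ (Fin d))
    (f : EuclideanSpace ℝ (Fin d) → ℝ) : ℝ :=
  ∑ i, w i * f (X i)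

/-- The worst-case error `e_n(P; W_2^r)` of the weighted points `(w, X)`, as an extended
nonnegative real. As point values matter, the elements of the unit ball of `W_2^r` (`r > d / 2`)
are taken as functions, namely as their continuous representatives. -/
def worstCaseError {d n : ℕ} (P : Measure (EuclideanSpace ℝ (Fin d))) (r : ℕ)
    (w : Fin n → ℝ) (X : Fin n → EuclideanSpace ℝ (Fin d)) : ℝ≥0∞ :=
  ⨆ (g : EuclideanSpace ℝ (Fin d) → ℝ) (_ : Continuous g ∧ MemW2 r g ∧ normW2 r g ≤ 1),
    ENNReal.ofReal |(∫ x, g x ∂P) - quadSum w X g|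

/-- The separation radius `min_{i ≠ j} ‖X i - X j‖` of finitely many points; it is `∞` if there
are fewer than two points. -/
def separationRadius {d n : ℕ} (X : Fin n → EuclideanSpace ℝ (Fin d)) : ℝ≥0∞ :=
  ⨅ (i : Fin n) (j : Fin n) (_ : i ≠ j), ENNReal.ofReal ‖X i - X j‖

end

/-! The natural length scale is `δ ~ n^{-b/r}`, which the separation condition allows. Suppose `f`
can be replaced by a smooth, compactly supported `g` that equals `f` at every `X_i`, is uniformly
`O(δ^s)`-close to `f` on the support of `P`, and has `W_2^r` norm `O(δ^{s-r})`. Then `P_n f = P_n g`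
exactly, so the uncontrolled weights do no harm; `|Pf - Pg| = O(δ^s)`; and `|Pg - P_n g| = O(n^{-b}
δ^{s-r})`. Both errors are `O(n^{-bs/r})`.

Localization (`exists_ball_of_worstCaseError`): testing `P_n → P` on bump functions traps the
points, and hence `P`, in a fixed ball, so `f` may be cut off to have compact support.

Construction of `g` (`exists_smooth_approx_interpolant`): with `S` convolution by a mollifier at
scale `δ`, the operator `1 - (1 - S)^s` gives a smooth function with error `O(δ^s)`, and only the
derivatives beyond the `s`-th cost factors `δ⁻¹`. The remaining errors at the points are removed by
bumps of radius `δ/3`, disjoint by separation, whose heights `O(δ^s)` respect the same derivative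
bounds. -/

/-- The iterated partial derivative along a list of directions; the head is applied last. -/
noncomputable def listDeriv {d : ℕ} (L : List (Fin d)) (h : EuclideanSpace ℝ (Fin d) → ℝ) :
    EuclideanSpace ℝ (Fin d) → ℝ :=
  L.foldr partialDeriv h

/-- `h` vanishes outside the closed ball of radius `R` around the origin. -/
def SupportedInBall {d : ℕ} (R : ℝ) (h : EuclideanSpace ℝ (Fin d) → ℝ) : Prop :=
  ∀ x, R < ‖x‖ → h x = 0

/-- All iterated partial derivatives of `h` of order at most `m` are bounded by `A`. -/
def DerivBound {d : ℕ} (m : ℕ) (A : ℝ) (h : EuclideanSpace ℝ (Fin d) → ℝ) : Prop :=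
  ∀ L : List (Fin d), L.length ≤ m → ∀ x, |listDeriv L h x| ≤ A

/-! ### Iterated partial derivatives, supports and scaling. -/

section Derivatives

variable {d : ℕ} {h : EuclideanSpace ℝ (Fin d) → ℝ} {R A : ℝ}

@[simp] lemma listDeriv_nil (h : EuclideanSpace ℝ (Fin d) → ℝ) : listDeriv [] h = h := rfl

@[simp] lemma listDeriv_cons (i : Fin d) (L : List (Fin d))
    (h : EuclideanSpace ℝ (Fin d) → ℝ) :
    listDeriv (i :: L) h = partialDeriv i (listDeriv L h) := rfl

lemma listDeriv_append (L L' : List (Fin d)) (h : EuclideanSpace ℝ (Fin d) → ℝ) :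
    listDeriv (L ++ L') h = listDeriv L (listDeriv L' h) := by
  simp [listDeriv]

lemma multiDeriv_eq_listDeriv (α : Fin d → ℕ) (h : EuclideanSpace ℝ (Fin d) → ℝ) :
    multiDeriv α h =
      listDeriv ((List.finRange d).flatMap fun i => List.replicate (α i) i) h := by
  have key : ∀ (k : ℕ) (i : Fin d) (g : EuclideanSpace ℝ (Fin d) → ℝ),
      (partialDeriv i)^[k] g = listDeriv (List.replicate k i) g := by
    intro k i g
    induction k with
    | zero => rfl
    | succ k ih => rw [Function.iterate_succ_apply', ih, List.replicate_succ, listDeriv_cons]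
  unfold multiDeriv
  induction List.finRange d with
  | nil => rfl
  | cons i l ih => rw [List.foldr_cons, ih, key, List.flatMap_cons, listDeriv_append]

lemma length_flatMap_replicate (α : Fin d → ℕ) :
    ((List.finRange d).flatMap fun i => List.replicate (α i) i).length = ∑ i, α i := by
  simp [List.length_flatMap, Fin.sum_univ_def]

lemma contDiff_partialDeriv {m n : ℕ∞} (i : Fin d) (hh : ContDiff ℝ m h) (hmn : n + 1 ≤ m) :
    ContDiff ℝ n (partialDeriv i h) :=
  (hh.fderiv_right (by exact_mod_cast hmn)).clm_apply contDiff_const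

lemma contDiff_listDeriv {m n : ℕ∞} (L : List (Fin d)) (hh : ContDiff ℝ m h)
    (hmn : n + L.length ≤ m) : ContDiff ℝ n (listDeriv L h) := by
  induction L generalizing n with
  | nil => exact hh.of_le (by simpa using hmn)
  | cons i L ih =>
    refine contDiff_partialDeriv i (ih (n := n + 1) ?_) le_rfl
    rw [List.length_cons] at hmn
    push_cast at hmn
    rwa [add_assoc, add_comm 1]

lemma contDiff_top_listDeriv (L : List (Fin d)) (hh : ContDiff ℝ ∞ h) :
    ContDiff ℝ ∞ (listDeriv L h) :=
  contDiff_listDeriv (m := ⊤) (n := ⊤) L hh (by simp)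

lemma SupportedInBall.mono {R' : ℝ} (hh : SupportedInBall R h) (hR : R ≤ R') :
    SupportedInBall R' h := fun x hx => hh x (hR.trans_lt hx)

lemma SupportedInBall.hasCompactSupport (hh : SupportedInBall R h) : HasCompactSupport h :=
  HasCompactSupport.intro (isCompact_closedBall 0 R) fun x hx => hh x (by simpa using hx)

lemma SupportedInBall.partialDeriv (hh : SupportedInBall R h) (i : Fin d) :
    SupportedInBall R (partialDeriv i h) := by
  intro x hx
  have : h =ᶠ[𝓝 x] fun _ => 0 := by
    filter_upwards [(isOpen_lt continuous_const continuous_norm).mem_nhds hx] with y hy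
    exact hh y hy
  simp [_root_.partialDeriv, this.fderiv_eq]

lemma SupportedInBall.listDeriv (hh : SupportedInBall R h) (L : List (Fin d)) :
    SupportedInBall R (listDeriv L h) := by
  induction L with
  | nil => exact hh
  | cons i L ih => exact ih.partialDeriv i

lemma partialDeriv_sub {g : EuclideanSpace ℝ (Fin d) → ℝ} (i : Fin d) (hh : ContDiff ℝ 1 h)
    (hg : ContDiff ℝ 1 g) :
    partialDeriv i (fun x => h x - g x) = fun x => partialDeriv i h x - partialDeriv i g x := by
  ext x
  simp only [partialDeriv]
  rw [fderiv_fun_sub (hh.differentiable one_ne_zero x) (hg.differentiable one_ne_zero x)]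
  rfl

lemma partialDeriv_const_mul (i : Fin d) (c : ℝ) (hh : ContDiff ℝ 1 h) :
    partialDeriv i (fun x => c * h x) = fun x => c * partialDeriv i h x := by
  ext x
  simp only [partialDeriv]
  rw [fderiv_const_mul (hh.differentiable one_ne_zero x)]
  rfl

lemma listDeriv_const_mul (L : List (Fin d)) (c : ℝ) (hh : ContDiff ℝ L.length h) :
    listDeriv L (fun x => c * h x) = fun x => c * listDeriv L h x := by
  induction L with
  | nil => rfl
  | cons i L ih =>
    rw [listDeriv_cons, listDeriv_cons, ih (hh.of_le (by simp)), partialDeriv_const_mul]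
    exact contDiff_listDeriv (m := ((L.length + 1 : ℕ) : ℕ∞)) (n := 1) L hh
      (by push_cast; rw [add_comm])

lemma listDeriv_sum {ι : Type*} (t : Finset ι) (L : List (Fin d))
    (g : ι → EuclideanSpace ℝ (Fin d) → ℝ) (hg : ∀ j ∈ t, ContDiff ℝ L.length (g j)) :
    listDeriv L (fun x => ∑ j ∈ t, g j x) = fun x => ∑ j ∈ t, listDeriv L (g j) x := by
  induction L with
  | nil => rfl
  | cons i L ih =>
    rw [listDeriv_cons, ih fun j hj => (hg j hj).of_le (by simp)]
    ext x
    simp only [partialDeriv, listDeriv_cons]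
    rw [fderiv_fun_sum]
    · simp
    · intro j hj
      refine (contDiff_listDeriv (m := ((L.length + 1 : ℕ) : ℕ∞)) (n := 1) L (hg j hj)
        (by push_cast; rw [add_comm])).differentiable (by simp) x

lemma partialDeriv_comp_smul_sub (i : Fin d) (a : ℝ) (c : EuclideanSpace ℝ (Fin d))
    (h : EuclideanSpace ℝ (Fin d) → ℝ) :
    partialDeriv i (fun x => h (a • (x - c))) = fun x => a * partialDeriv i h (a • (x - c)) := by
  ext x
  simp only [partialDeriv]
  rw [fderiv_comp_sub (f := fun y => h (a • y)) c, fderiv_comp_smul]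
  rfl

lemma listDeriv_comp_smul_sub (L : List (Fin d)) (a : ℝ) (c : EuclideanSpace ℝ (Fin d))
    (hh : ContDiff ℝ L.length h) :
    listDeriv L (fun x => h (a • (x - c))) =
      fun x => a ^ L.length * listDeriv L h (a • (x - c)) := by
  induction L with
  | nil => simp
  | cons i L ih =>
    rw [listDeriv_cons, ih (hh.of_le (by simp)), partialDeriv_const_mul,
      partialDeriv_comp_smul_sub]
    · ext x
      simp only [List.length_cons, listDeriv_cons]
      ring
    · exact (contDiff_listDeriv (m := ((L.length + 1 : ℕ) : ℕ∞)) (n := 1) L hh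
        (by push_cast; rw [add_comm])).comp (by fun_prop)

/-- A compactly supported `C^m` function has bounded derivatives up to order `m`. -/
lemma exists_derivBound {m : ℕ} (hh : ContDiff ℝ m h) (hsupp : SupportedInBall R h) :
    ∃ A, 0 ≤ A ∧ DerivBound m A h := by
  have hb : ∀ L : List (Fin d), ∃ A : ℝ, L.length ≤ m → ∀ x, |listDeriv L h x| ≤ A := by
    intro L
    by_cases hL : L.length ≤ m
    · have hc : Continuous (listDeriv L h) :=
        (contDiff_listDeriv (m := m) (n := 0) L hh (by simpa using hL)).continuous
      obtain ⟨A, hA⟩ := hc.bounded_above_of_compact_support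
        (hsupp.listDeriv L).hasCompactSupport
      exact ⟨A, fun _ => hA⟩
    · exact ⟨0, fun h => absurd h hL⟩
  choose A hA using hb
  -- Only finitely many lists of directions have length at most `m`.
  obtain ⟨B, hB⟩ := ((List.finite_length_le (Fin d) m).image A).bddAbove
  refine ⟨max B 0, le_max_right _ _, fun L hL x => ?_⟩
  exact (hA L hL x).trans ((hB ⟨L, hL, rfl⟩).trans (le_max_left _ _))

end Derivatives

/-! ### Weak derivatives and the Sobolev norm of test functions. -/

section Sobolev

variable {d : ℕ} {h : EuclideanSpace ℝ (Fin d) → ℝ} {R A : ℝ}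

/-- Integration by parts strips the outermost derivative off `φ` first, hence the reversed list; no
symmetry of mixed partials is needed. -/
lemma integral_mul_listDeriv (L : List (Fin d)) {φ : EuclideanSpace ℝ (Fin d) → ℝ}
    (hh : ContDiff ℝ ∞ h) (hsupp : HasCompactSupport h) (hφ : ContDiff ℝ ∞ φ) :
    ∫ x, h x * listDeriv L φ x = (-1) ^ L.length * ∫ x, listDeriv L.reverse h x * φ x := by
  induction L generalizing h with
  | nil => simp
  | cons i L ih =>
    have hc : Continuous (partialDeriv i h) :=
      (contDiff_top_listDeriv [i] hh).continuous
    have hs : HasCompactSupport (partialDeriv i h) :=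
      hsupp.fderiv_apply ℝ (EuclideanSpace.single i 1)
    have hL := contDiff_top_listDeriv L hφ
    have hparts : ∫ x, h x * listDeriv (i :: L) φ x =
        -∫ x, partialDeriv i h x * listDeriv L φ x := by
      refine integral_mul_fderiv_eq_neg_fderiv_mul_of_integrable ?_ ?_ ?_ ?_ ?_
      · exact (hc.mul hL.continuous).integrable_of_hasCompactSupport hs.mul_right
      · exact (hh.continuous.mul (contDiff_top_listDeriv (i :: L) hφ).continuous)
          |>.integrable_of_hasCompactSupport hsupp.mul_right
      · exact (hh.continuous.mul hL.continuous).integrable_of_hasCompactSupport hsupp.mul_right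
      · exact fun x _ => hh.differentiable (by simp) x
      · exact fun x _ => hL.differentiable (by simp) x
    rw [hparts, ih (h := partialDeriv i h) (contDiff_top_listDeriv [i] hh) hs, List.reverse_cons,
      listDeriv_append]
    simp only [List.length_cons, listDeriv_cons, listDeriv_nil]
    ring

lemma hasWeakDeriv_of_contDiff (α : Fin d → ℕ) (hh : ContDiff ℝ ∞ h)
    (hsupp : HasCompactSupport h) :
    HasWeakDeriv α h
      (listDeriv ((List.finRange d).flatMap fun i => List.replicate (α i) i).reverse h) := by
  refine ⟨hh.continuous.locallyIntegrable,
    (contDiff_top_listDeriv _ hh).continuous.locallyIntegrable, fun φ hφ _ => ?_⟩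
  rw [multiDeriv_eq_listDeriv, integral_mul_listDeriv _ hh hsupp hφ, length_flatMap_replicate]

/-- The fundamental lemma of the calculus of variations. It lets the representative chosen by
`weakDeriv` be replaced by the classical derivative. -/
lemma HasWeakDeriv.ae_eq {α : Fin d → ℕ} {f g g' : EuclideanSpace ℝ (Fin d) → ℝ}
    (hg : HasWeakDeriv α f g) (hg' : HasWeakDeriv α f g') : g =ᵐ[volume] g' := by
  refine ae_eq_of_integral_contDiff_smul_eq hg.2.1 hg'.2.1 fun φ hφ hφs => ?_
  have := (hg.2.2 φ hφ hφs).symm.trans (hg'.2.2 φ hφ hφs)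
  have := mul_left_cancel₀ (pow_ne_zero _ (by norm_num)) this
  simpa only [smul_eq_mul, mul_comm] using this

lemma weakDeriv_ae_eq {α : Fin d → ℕ} {f g : EuclideanSpace ℝ (Fin d) → ℝ}
    (hg : HasWeakDeriv α f g) : weakDeriv α f =ᵐ[volume] g := by
  have hex : ∃ g, HasWeakDeriv α f g := ⟨g, hg⟩
  rw [weakDeriv, dif_pos hex]
  exact hex.choose_spec.ae_eq hg

lemma memW2_of_contDiff (r : ℕ) (hh : ContDiff ℝ ∞ h) (hR : SupportedInBall R h) :
    MemW2 r h :=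
  ⟨hh.continuous.memLp_of_hasCompactSupport hR.hasCompactSupport, fun α _ =>
    ⟨_, hasWeakDeriv_of_contDiff α hh hR.hasCompactSupport,
      (contDiff_top_listDeriv _ hh).continuous.memLp_of_hasCompactSupport
        (hR.listDeriv _).hasCompactSupport⟩⟩

/-- The Sobolev norm of a smooth function supported in a fixed ball is controlled by the supremum
of its derivatives. -/
lemma exists_normW2_le (d r : ℕ) (R : ℝ) :
    ∃ K, 0 < K ∧ ∀ (h : EuclideanSpace ℝ (Fin d) → ℝ) (A : ℝ), 0 ≤ A → ContDiff ℝ ∞ h →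
      SupportedInBall R h → DerivBound r A h → normW2 r h ≤ K * A := by
  set V : ℝ := (volume (Metric.closedBall (0 : EuclideanSpace ℝ (Fin d)) R)).toReal ^ (1 / 2 : ℝ)
  have hV : 0 ≤ V := by positivity
  set N : ℝ := ((multiIndices d r).card : ℝ)
  have hN : 0 ≤ N := by positivity
  -- The `+ 1` makes the constant strictly positive, so that it can be divided by when normalizing.
  refine ⟨Real.sqrt (N * V ^ 2) + 1, by positivity, fun h A hA hh hR hb => ?_⟩
  have hterm : ∀ α ∈ multiIndices d r,
      (eLpNorm (weakDeriv α h) 2 volume).toReal ^ 2 ≤ (V * A) ^ 2 := by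
    intro α hα
    set L := ((List.finRange d).flatMap fun i => List.replicate (α i) i).reverse
    have hlen : L.length ≤ r := by
      rw [List.length_reverse, length_flatMap_replicate]
      exact (Finset.mem_filter.1 hα).2
    have hle : eLpNorm (weakDeriv α h) 2 volume ≤
        volume (Metric.closedBall (0 : EuclideanSpace ℝ (Fin d)) R) ^ (1 / 2 : ℝ) *
          ENNReal.ofReal A := by
      rw [eLpNorm_congr_ae (weakDeriv_ae_eq
        (hasWeakDeriv_of_contDiff α hh hR.hasCompactSupport))]
      have hind : listDeriv L h =
          (Metric.closedBall (0 : EuclideanSpace ℝ (Fin d)) R).indicator (listDeriv L h) := by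
        ext x
        by_cases hx : x ∈ Metric.closedBall (0 : EuclideanSpace ℝ (Fin d)) R
        · rw [Set.indicator_of_mem hx]
        · rw [Set.indicator_of_notMem hx, hR.listDeriv L x (by simpa using hx)]
      rw [hind, eLpNorm_indicator_eq_eLpNorm_restrict Metric.isClosed_closedBall.measurableSet]
      refine (eLpNorm_le_of_ae_bound (C := A) (Eventually.of_forall fun x => hb L hlen x)).trans ?_
      simp
    have hfin : volume (Metric.closedBall (0 : EuclideanSpace ℝ (Fin d)) R) ^ (1 / 2 : ℝ) *
          ENNReal.ofReal A ≠ ⊤ :=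
      ENNReal.mul_ne_top (ENNReal.rpow_ne_top_of_nonneg (by norm_num)
        measure_closedBall_lt_top.ne) ENNReal.ofReal_ne_top
    have := ENNReal.toReal_mono hfin hle
    rw [ENNReal.toReal_mul, ← ENNReal.toReal_rpow, ENNReal.toReal_ofReal hA] at this
    gcongr
  calc normW2 r h ≤ Real.sqrt (∑ α ∈ multiIndices d r, (V * A) ^ 2) :=
        Real.sqrt_le_sqrt (Finset.sum_le_sum hterm)
    _ = Real.sqrt (N * V ^ 2) * A := by
        rw [Finset.sum_const, nsmul_eq_mul, mul_pow, ← mul_assoc,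
          Real.sqrt_mul (by positivity), Real.sqrt_sq hA]
    _ ≤ (Real.sqrt (N * V ^ 2) + 1) * A := by gcongr; linarith

end Sobolev

/-! ### Mollification and its iterated error. -/

/-- Convolution of `h` with the kernel `κ`. -/
noncomputable def smoothBy {d : ℕ} (κ h : EuclideanSpace ℝ (Fin d) → ℝ) :
    EuclideanSpace ℝ (Fin d) → ℝ :=
  convolution κ h (ContinuousLinearMap.mul ℝ ℝ) volume

/-- The error `h - κ ⋆ h` of smoothing. -/
noncomputable def smoothErr {d : ℕ} (κ h : EuclideanSpace ℝ (Fin d) → ℝ) :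
    EuclideanSpace ℝ (Fin d) → ℝ :=
  fun x => h x - smoothBy κ h x

/-- The kernel `κ` rescaled to length scale `δ`, preserving its integral. -/
noncomputable def rescale {d : ℕ} (δ : ℝ) (κ : EuclideanSpace ℝ (Fin d) → ℝ) :
    EuclideanSpace ℝ (Fin d) → ℝ :=
  fun x => (δ ^ d)⁻¹ * κ (δ⁻¹ • (x - 0))

section Smoothing

variable {d : ℕ} {κ h : EuclideanSpace ℝ (Fin d) → ℝ} {R A δ : ℝ}

lemma smoothBy_apply (κ h : EuclideanSpace ℝ (Fin d) → ℝ) (x : EuclideanSpace ℝ (Fin d)) :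
    smoothBy κ h x = ∫ t, κ t * h (x - t) := rfl

lemma smoothBy_comm (κ h : EuclideanSpace ℝ (Fin d) → ℝ) : smoothBy κ h = smoothBy h κ := by
  unfold smoothBy
  rw [← convolution_flip, ContinuousLinearMap.flip_mul]

lemma contDiff_smoothBy {m : ℕ∞} (hκ : Continuous κ) (hh : ContDiff ℝ m h)
    (hsupp : HasCompactSupport h) : ContDiff ℝ m (smoothBy κ h) :=
  hsupp.contDiff_convolution_right _ hκ.locallyIntegrable hh

lemma partialDeriv_smoothBy (i : Fin d) (hκ : Continuous κ) (hh : ContDiff ℝ 1 h)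
    (hsupp : HasCompactSupport h) :
    partialDeriv i (smoothBy κ h) = smoothBy κ (partialDeriv i h) := by
  ext x
  have := hsupp.hasFDerivAt_convolution_right (ContinuousLinearMap.mul ℝ ℝ)
    (μ := volume) hκ.locallyIntegrable hh x
  rw [partialDeriv, smoothBy, this.fderiv,
    convolution_precompR_apply _ hκ.locallyIntegrable (hsupp.fderiv ℝ)
      (hh.continuous_fderiv one_ne_zero)]
  rfl

lemma listDeriv_smoothBy (L : List (Fin d)) (hκ : Continuous κ) (hh : ContDiff ℝ L.length h)
    (hsupp : SupportedInBall R h) :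
    listDeriv L (smoothBy κ h) = smoothBy κ (listDeriv L h) := by
  induction L with
  | nil => rfl
  | cons i L ih =>
    rw [listDeriv_cons, ih (hh.of_le (by simp)), partialDeriv_smoothBy i hκ _
      (hsupp.listDeriv L).hasCompactSupport, listDeriv_cons]
    exact contDiff_listDeriv (m := ((L.length + 1 : ℕ) : ℕ∞)) (n := 1) L hh
      (by push_cast; rw [add_comm])

/-- Derivatives may fall on the kernel instead, which is how orders beyond the smoothness of `h` are
reached. -/
lemma listDeriv_smoothBy_left (L : List (Fin d)) (hκ : ContDiff ℝ ∞ κ)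
    (hsupp : SupportedInBall R κ) (hh : Continuous h) :
    listDeriv L (smoothBy κ h) = smoothBy (listDeriv L κ) h := by
  rw [smoothBy_comm, listDeriv_smoothBy L hh (hκ.of_le (by exact_mod_cast le_top)) hsupp,
    smoothBy_comm]

lemma abs_smoothBy_le (hκ : Integrable κ) (hh : ∀ x, |h x| ≤ A) (x : EuclideanSpace ℝ (Fin d)) :
    |smoothBy κ h x| ≤ (∫ t, |κ t|) * A := by
  rw [smoothBy_apply, ← integral_mul_const]
  refine norm_integral_le_of_norm_le (f := fun t => κ t * h (x - t)) (hκ.abs.mul_const A)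
    (Eventually.of_forall fun t => ?_)
  rw [Real.norm_eq_abs, abs_mul]
  exact mul_le_mul_of_nonneg_left (hh _) (abs_nonneg _)

lemma SupportedInBall.smoothBy (hκ : SupportedInBall δ κ) (hh : SupportedInBall R h) :
    SupportedInBall (R + δ) (smoothBy κ h) := by
  intro x hx
  rw [smoothBy_apply]
  refine integral_eq_zero_of_ae (Eventually.of_forall fun t => ?_)
  by_cases ht : δ < ‖t‖
  · simp [hκ t ht]
  · have : R < ‖x - t‖ := by linarith [norm_sub_norm_le x t]
    simp [hh _ this]

lemma SupportedInBall.smoothErr (hκ : SupportedInBall δ κ) (hδ : 0 ≤ δ)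
    (hh : SupportedInBall R h) : SupportedInBall (R + δ) (smoothErr κ h) := by
  intro x hx
  simp [_root_.smoothErr, (hκ.smoothBy hh) x hx, hh x (by linarith)]

lemma SupportedInBall.iterate_smoothErr (hκ : SupportedInBall δ κ) (hδ : 0 ≤ δ)
    (hh : SupportedInBall R h) (k : ℕ) :
    SupportedInBall (R + k * δ) ((_root_.smoothErr κ)^[k] h) := by
  induction k with
  | zero => simpa using hh
  | succ k ih =>
    rw [Function.iterate_succ_apply']
    refine (hκ.smoothErr hδ ih).mono (le_of_eq ?_)
    push_cast; ring

lemma contDiff_iterate_smoothErr {m : ℕ∞} (hκ : Continuous κ) (hκs : SupportedInBall δ κ)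
    (hδ : 0 ≤ δ) (hh : ContDiff ℝ m h) (hsupp : SupportedInBall R h) (k : ℕ) :
    ContDiff ℝ m ((smoothErr κ)^[k] h) := by
  induction k with
  | zero => simpa using hh
  | succ k ih =>
    rw [Function.iterate_succ_apply']
    exact ih.sub (contDiff_smoothBy hκ ih (hκs.iterate_smoothErr hδ hsupp k).hasCompactSupport)

lemma partialDeriv_iterate_smoothErr (i : Fin d) (hκ : Continuous κ)
    (hκs : SupportedInBall δ κ) (hδ : 0 ≤ δ) (hh : ContDiff ℝ 1 h)
    (hsupp : SupportedInBall R h) (k : ℕ) :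
    partialDeriv i ((smoothErr κ)^[k] h) = (smoothErr κ)^[k] (partialDeriv i h) := by
  induction k with
  | zero => rfl
  | succ k ih =>
    have hc := contDiff_iterate_smoothErr (m := 1) hκ hκs hδ hh hsupp k
    have hs := (hκs.iterate_smoothErr hδ hsupp k).hasCompactSupport
    rw [Function.iterate_succ_apply', Function.iterate_succ_apply', ← ih]
    change partialDeriv i (fun x => (smoothErr κ)^[k] h x - smoothBy κ ((smoothErr κ)^[k] h) x) = _
    rw [partialDeriv_sub i hc (contDiff_smoothBy (m := 1) hκ hc hs),
      partialDeriv_smoothBy i hκ hc hs]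
    rfl

lemma listDeriv_iterate_smoothErr (L : List (Fin d)) (hκ : Continuous κ)
    (hκs : SupportedInBall δ κ) (hδ : 0 ≤ δ) (hh : ContDiff ℝ L.length h)
    (hsupp : SupportedInBall R h) (k : ℕ) :
    listDeriv L ((smoothErr κ)^[k] h) = (smoothErr κ)^[k] (listDeriv L h) := by
  induction L with
  | nil => rfl
  | cons i L ih =>
    rw [listDeriv_cons, ih (hh.of_le (by simp)), partialDeriv_iterate_smoothErr i hκ hκs hδ _
      (hsupp.listDeriv L), listDeriv_cons]
    exact contDiff_listDeriv (m := ((L.length + 1 : ℕ) : ℕ∞)) (n := 1) L hh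
      (by push_cast; rw [add_comm])

lemma abs_iterate_smoothErr_le {I : ℝ} (hκ : Integrable κ) (hI : ∫ t, |κ t| ≤ I)
    (hA : ∀ x, |h x| ≤ A) (k : ℕ) (x : EuclideanSpace ℝ (Fin d)) :
    |(smoothErr κ)^[k] h x| ≤ (1 + I) ^ k * A := by
  induction k generalizing x with
  | zero => simpa using hA x
  | succ k ih =>
    rw [Function.iterate_succ_apply', smoothErr]
    refine (abs_sub _ _).trans ?_
    have h0 : 0 ≤ (1 + I) ^ k * A := (abs_nonneg _).trans (ih x)
    have := abs_smoothBy_le hκ ih x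
    calc _ ≤ (1 + I) ^ k * A + (∫ t, |κ t|) * ((1 + I) ^ k * A) := add_le_add (ih x) this
      _ ≤ (1 + I) ^ k * A + I * ((1 + I) ^ k * A) := by gcongr
      _ = _ := by ring

lemma abs_sub_le_of_partialDeriv (hh : ContDiff ℝ 1 h) (hA : ∀ i x, |partialDeriv i h x| ≤ A)
    (x y : EuclideanSpace ℝ (Fin d)) : |h x - h y| ≤ d * A * ‖x - y‖ := by
  refine Convex.norm_image_sub_le_of_norm_fderiv_le (𝕜 := ℝ) (s := Set.univ) (f := h)
    (fun z _ => hh.differentiable one_ne_zero z) (fun z _ => ?_) convex_univ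
    (Set.mem_univ y) (Set.mem_univ x)
  have hA0 : 0 ≤ (d : ℝ) * A := by
    rcases Nat.eq_zero_or_pos d with rfl | hd
    · simp
    · exact mul_nonneg (by positivity) ((abs_nonneg _).trans (hA ⟨0, hd⟩ z))
  refine ContinuousLinearMap.opNorm_le_bound _ hA0 fun v => ?_
  have hv : v = ∑ i, v i • EuclideanSpace.single i (1 : ℝ) := by
    ext j
    simp [Finset.sum_apply, Pi.single_apply]
  calc ‖fderiv ℝ h z v‖ = ‖∑ i, v i * partialDeriv i h z‖ := by
        conv_lhs => rw [hv]
        simp [partialDeriv]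
    _ ≤ ∑ i, ‖v i * partialDeriv i h z‖ := norm_sum_le _ _
    _ ≤ ∑ _i : Fin d, ‖v‖ * A := by
        refine Finset.sum_le_sum fun i _ => ?_
        rw [norm_mul]
        exact mul_le_mul (PiLp.norm_apply_le v i) (hA i z) (norm_nonneg _) (norm_nonneg _)
    _ = d * A * ‖v‖ := by simp; ring

/-- `κ ⋆ h` averages `h` over distances at most `δ`, and `h` is Lipschitz with constant `d * A`. -/
lemma abs_smoothErr_le (hκ : Continuous κ) (hκ0 : ∀ x, 0 ≤ κ x) (hκ1 : ∫ t, κ t = 1)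
    (hκs : SupportedInBall δ κ) (hh : ContDiff ℝ 1 h) (hA : ∀ i x, |partialDeriv i h x| ≤ A)
    (x : EuclideanSpace ℝ (Fin d)) : |smoothErr κ h x| ≤ d * A * δ := by
  have hκi : Integrable κ := hκ.integrable_of_hasCompactSupport hκs.hasCompactSupport
  have h1 : h x = ∫ t, κ t * h x := by rw [integral_mul_const, hκ1, one_mul]
  have hint : Integrable fun t => κ t * h (x - t) :=
    (hκ.mul (hh.continuous.comp (by fun_prop))).integrable_of_hasCompactSupport
      hκs.hasCompactSupport.mul_right
  rw [smoothErr, smoothBy_apply, h1, ← integral_sub (hκi.mul_const _) hint]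
  calc |∫ t, κ t * h x - κ t * h (x - t)| ≤ ∫ t, κ t * (d * A * δ) := by
        refine norm_integral_le_of_norm_le (f := fun t => κ t * h x - κ t * h (x - t))
          (hκi.mul_const _) (Eventually.of_forall fun t => ?_)
        rw [← mul_sub, Real.norm_eq_abs, abs_mul, abs_of_nonneg (hκ0 t)]
        by_cases ht : δ < ‖t‖
        · simp [hκs t ht]
        · refine mul_le_mul_of_nonneg_left ?_ (hκ0 t)
          have h2 := abs_sub_le_of_partialDeriv hh hA x (x - t)
          rw [sub_sub_cancel] at h2
          refine h2.trans (mul_le_mul_of_nonneg_left (not_lt.1 ht) ?_)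
          rcases Nat.eq_zero_or_pos d with rfl | hd
          · simp
          · exact mul_nonneg (by positivity) ((abs_nonneg _).trans (hA ⟨0, hd⟩ x))
    _ = d * A * δ := by rw [integral_mul_const, hκ1, one_mul]

/-- The `s`-fold iterated smoothing error at scale `δ` of a `C^s` function is of order `δ^s`. -/
lemma abs_iterate_smoothErr_le_pow (hκ : Continuous κ) (hκ0 : ∀ x, 0 ≤ κ x)
    (hκ1 : ∫ t, κ t = 1) (hδ : 0 ≤ δ) (hκs : SupportedInBall δ κ) (s : ℕ)
    (hh : ContDiff ℝ s h) (hsupp : SupportedInBall R h)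
    (hA : ∀ L : List (Fin d), L.length = s → ∀ x, |listDeriv L h x| ≤ A)
    (x : EuclideanSpace ℝ (Fin d)) :
    |(smoothErr κ)^[s] h x| ≤ (d * δ) ^ s * A := by
  induction s generalizing h x with
  | zero => simpa using hA [] rfl x
  | succ s ih =>
    have h1 : ContDiff ℝ 1 h := hh.of_le (by simp)
    rw [Function.iterate_succ_apply']
    -- Smoothing commutes with derivatives, so each further `smoothErr` trades one derivative for a
    -- factor `d * δ`. Only first-order accuracy of the kernel is used; no vanishing moments are
    -- required.
    have hb : ∀ i x, |partialDeriv i ((smoothErr κ)^[s] h) x| ≤ (d * δ) ^ s * A := by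
      intro i x
      rw [partialDeriv_iterate_smoothErr i hκ hκs hδ h1 hsupp]
      refine ih (contDiff_partialDeriv (m := ((s + 1 : ℕ) : ℕ∞)) (n := s) i hh (by simp))
        (hsupp.partialDeriv i) (fun L hL y => ?_) x
      have := hA (L ++ [i]) (by simp [hL]) y
      rwa [listDeriv_append] at this
    refine (abs_smoothErr_le hκ hκ0 hκ1 hκs
      (contDiff_iterate_smoothErr (m := 1) hκ hκs hδ h1 hsupp s) hb x).trans (le_of_eq ?_)
    ring

lemma SupportedInBall.rescale (hκ : SupportedInBall 1 κ) (hδ : 0 < δ) :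
    SupportedInBall δ (rescale δ κ) := by
  intro x hx
  have : 1 < ‖δ⁻¹ • (x - 0)‖ := by
    rw [norm_smul, sub_zero, Real.norm_eq_abs, abs_of_pos (inv_pos.2 hδ), inv_mul_eq_div,
      one_lt_div hδ]
    exact hx
  rw [_root_.rescale, hκ _ this, mul_zero]

lemma contDiff_rescale {m : ℕ∞} (hκ : ContDiff ℝ m κ) : ContDiff ℝ m (rescale δ κ) :=
  contDiff_const.mul (hκ.comp (by fun_prop))

lemma integral_rescale (hδ : 0 < δ) : ∫ t, rescale δ κ t = ∫ t, κ t := by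
  simp only [rescale, sub_zero]
  rw [integral_const_mul, Measure.integral_comp_inv_smul_of_nonneg volume κ hδ.le,
    finrank_euclideanSpace_fin, smul_eq_mul, inv_mul_cancel_left₀ (pow_pos hδ d).ne']

lemma listDeriv_rescale (L : List (Fin d)) (hκ : ContDiff ℝ ∞ κ) (δ : ℝ) :
    listDeriv L (rescale δ κ) = fun x => δ⁻¹ ^ L.length * rescale δ (listDeriv L κ) x := by
  have hκ' : ContDiff ℝ L.length κ := hκ.of_le (by exact_mod_cast le_top)
  unfold rescale
  -- The form `x - 0` in `rescale` lets the chain rule for `a • (x - c)` apply with `c = 0`.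
  rw [listDeriv_const_mul (h := fun x => κ (δ⁻¹ • (x - 0))) L _ (hκ'.comp (by fun_prop)),
    listDeriv_comp_smul_sub L _ _ hκ']
  ext x
  ring

lemma integral_abs_listDeriv_rescale (L : List (Fin d)) (hκ : ContDiff ℝ ∞ κ) (hδ : 0 < δ) :
    ∫ t, |listDeriv L (rescale δ κ) t| = δ⁻¹ ^ L.length * ∫ t, |listDeriv L κ t| := by
  rw [listDeriv_rescale L hκ, ← integral_rescale (κ := fun t => |listDeriv L κ t|) hδ,
    ← integral_const_mul]
  refine integral_congr_ae (Eventually.of_forall fun t => ?_)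
  simp only [rescale, abs_mul]
  rw [abs_of_nonneg (pow_nonneg (inv_nonneg.2 hδ.le) L.length),
    abs_of_nonneg (inv_nonneg.2 (pow_nonneg hδ.le d))]

end Smoothing

/-! ### Smooth approximation and interpolation at scale `δ`. -/

section Approximation

variable {d : ℕ} {h : EuclideanSpace ℝ (Fin d) → ℝ} {R : ℝ}

/-- The telescoping identity `1 - ∑_{k<s} S (1 - S)^k = (1 - S)^s`. -/
lemma sub_sum_smoothBy (κ h : EuclideanSpace ℝ (Fin d) → ℝ) (s : ℕ)
    (x : EuclideanSpace ℝ (Fin d)) :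
    h x - ∑ k ∈ Finset.range s, smoothBy κ ((smoothErr κ)^[k] h) x = (smoothErr κ)^[s] h x := by
  induction s with
  | zero => simp
  | succ s ih =>
    rw [Finset.sum_range_succ, ← sub_sub, ih, Function.iterate_succ_apply']
    rfl

/-- A nonnegative smooth kernel of integral one supported in the unit ball. -/
lemma exists_smoothing_kernel (d : ℕ) :
    ∃ κ : EuclideanSpace ℝ (Fin d) → ℝ, ContDiff ℝ ∞ κ ∧ (∀ x, 0 ≤ κ x) ∧
      SupportedInBall 1 κ ∧ ∫ t, κ t = 1 := by
  let φ : ContDiffBump (0 : EuclideanSpace ℝ (Fin d)) := ⟨1 / 2, 1, by norm_num, by norm_num⟩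
  refine ⟨φ.normed volume, φ.contDiff_normed, φ.nonneg_normed, fun x hx => ?_,
    φ.integral_normed⟩
  rw [ContDiffBump.normed_def, φ.zero_of_le_dist (by simpa [φ] using hx.le), zero_div]

/-- Smooth approximation at length scale `δ` of a compactly supported `C^s` function: the error is
of order `δ^s`, and the derivatives up to order `r` blow up at most like `δ^{-(r - s)}`. -/
lemma exists_smooth_approx (s r : ℕ) (hh : ContDiff ℝ s h)
    (hsupp : SupportedInBall R h) :
    ∃ A, 0 ≤ A ∧ ∀ δ : ℝ, 0 < δ → δ ≤ 1 → ∃ g : EuclideanSpace ℝ (Fin d) → ℝ,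
      ContDiff ℝ ∞ g ∧ SupportedInBall (R + s) g ∧ (∀ x, |h x - g x| ≤ A * δ ^ s) ∧
      DerivBound r (A * δ⁻¹ ^ (r - s)) g := by
  obtain ⟨κ, hκ, hκ0, hκs, hκ1⟩ := exists_smoothing_kernel d
  obtain ⟨A, hA0, hA⟩ := exists_derivBound hh hsupp
  obtain ⟨I, hI⟩ := ((List.finite_length_le (Fin d) r).image
    fun L => ∫ t, |listDeriv L κ t|).bddAbove
  have hI : ∀ L : List (Fin d), L.length ≤ r → ∫ t, |listDeriv L κ t| ≤ I :=
    fun L hL => hI ⟨L, hL, rfl⟩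
  have hI0 : 0 ≤ I := (integral_nonneg fun t => abs_nonneg _).trans (hI [] (Nat.zero_le _))
  refine ⟨d ^ s * A + s * (I * ((1 + I) ^ s * A)), by positivity, fun δ hδ hδ1 => ?_⟩
  set ρ := rescale δ κ
  have hρ : ContDiff ℝ ∞ ρ := contDiff_rescale (m := ⊤) hκ
  have hρs : SupportedInBall δ ρ := hκs.rescale hδ
  have hρ0 : ∀ x, 0 ≤ ρ x := fun x =>
    mul_nonneg (inv_nonneg.2 (pow_nonneg hδ.le _)) (hκ0 _)
  have hρ1 : ∫ t, ρ t = 1 := (integral_rescale hδ).trans hκ1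
  have hρI : ∀ L : List (Fin d), Integrable (listDeriv L ρ) := fun L =>
    (contDiff_top_listDeriv L hρ).continuous.integrable_of_hasCompactSupport
      (hρs.listDeriv L).hasCompactSupport
  have habs : ∫ t, |ρ t| ≤ I := by
    have := integral_abs_listDeriv_rescale [] hκ hδ
    simp only [List.length_nil, pow_zero, one_mul] at this
    exact this.trans_le (hI [] (Nat.zero_le _))
  have hTc : ∀ k, Continuous ((smoothErr ρ)^[k] h) := fun k =>
    (contDiff_iterate_smoothErr (m := s) hρ.continuous hρs hδ.le hh hsupp k).continuous
  have hterm : ∀ k, ContDiff ℝ ∞ (smoothBy ρ ((smoothErr ρ)^[k] h)) := by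
    intro k
    rw [smoothBy_comm]
    exact contDiff_smoothBy (m := ⊤) (hTc k) hρ hρs.hasCompactSupport
  refine ⟨fun x => ∑ k ∈ Finset.range s, smoothBy ρ ((smoothErr ρ)^[k] h) x,
    ContDiff.sum fun k _ => hterm k, ?_, ?_, ?_⟩
  · intro x hx
    refine Finset.sum_eq_zero fun k hk => ?_
    refine hρs.smoothBy (hρs.iterate_smoothErr hδ.le hsupp k) x (lt_of_le_of_lt ?_ hx)
    have hk : (k : ℝ) + 1 ≤ s := by exact_mod_cast Finset.mem_range.1 hk
    nlinarith
  · intro x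
    rw [sub_sum_smoothBy]
    refine (abs_iterate_smoothErr_le_pow hρ.continuous hρ0 hρ1 hδ.le hρs s hh hsupp
      (fun L hL => hA L hL.le) x).trans ?_
    rw [mul_pow, mul_right_comm]
    have : 0 ≤ s * (I * ((1 + I) ^ s * A)) := by positivity
    gcongr
    linarith
  · intro L hL x
    rw [listDeriv_sum _ _ _ fun k _ => (hterm k).of_le (by exact_mod_cast le_top)]
    have hsummand : ∀ k ∈ Finset.range s, |listDeriv L (smoothBy ρ ((smoothErr ρ)^[k] h)) x| ≤
        I * ((1 + I) ^ s * A) * δ⁻¹ ^ (r - s) := by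
      intro k hk
      have hks : k ≤ s := (Finset.mem_range.1 hk).le
      -- At most `s` innermost derivatives go to `h`; the at most `r - s` outer ones go to the
      -- kernel, each costing `δ⁻¹`. Truncated subtraction makes `L₁` empty when `L` is no longer
      -- than `s`.
      set L₁ := L.take (L.length - s)
      set L₂ := L.drop (L.length - s)
      have hL₁ : L₁.length ≤ r - s := by simp only [L₁, List.length_take]; omega
      have hL₂ : L₂.length ≤ s := by simp only [L₂, List.length_drop]; omega
      have hh₂ : ContDiff ℝ L₂.length h := hh.of_le (by exact_mod_cast hL₂)
      have hT₂ : ContDiff ℝ (L₂.length : ℕ∞) ((smoothErr ρ)^[k] h) :=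
        contDiff_iterate_smoothErr hρ.continuous hρs hδ.le hh₂ hsupp k
      have hT₂' : Continuous (listDeriv L₂ ((smoothErr ρ)^[k] h)) :=
        (contDiff_listDeriv (n := 0) L₂ hT₂ (by simp)).continuous
      rw [← List.take_append_drop (L.length - s) L, listDeriv_append,
        listDeriv_smoothBy _ hρ.continuous hT₂ (hρs.iterate_smoothErr hδ.le hsupp k),
        listDeriv_smoothBy_left _ hρ hρs hT₂',
        listDeriv_iterate_smoothErr _ hρ.continuous hρs hδ.le hh₂ hsupp]
      have hbd := abs_iterate_smoothErr_le (h := listDeriv L₂ h) (hρI []) habs (hA L₂ hL₂) k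
      refine (abs_smoothBy_le (hρI L₁) hbd x).trans ?_
      rw [integral_abs_listDeriv_rescale L₁ hκ hδ]
      have hδ' : 1 ≤ δ⁻¹ := (one_le_inv₀ hδ).2 hδ1
      calc δ⁻¹ ^ L₁.length * (∫ t, |listDeriv L₁ κ t|) * ((1 + I) ^ k * A)
          ≤ δ⁻¹ ^ (r - s) * I * ((1 + I) ^ s * A) := by
            gcongr
            · exact hI L₁ (hL₁.trans (Nat.sub_le _ _))
            · linarith
        _ = _ := by ring
    refine (Finset.abs_sum_le_sum_abs _ _).trans ((Finset.sum_le_sum hsummand).trans ?_)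
    rw [Finset.sum_const, Finset.card_range, nsmul_eq_mul, ← mul_assoc]
    have : 0 ≤ (d : ℝ) ^ s * A := by positivity
    gcongr
    linarith

/-- Smooth interpolation of values bounded by `B` at `δ`-separated points, with derivatives of
order `m` bounded by a multiple of `B * δ^{-m}`. -/
lemma exists_smooth_interpolant (d r : ℕ) :
    ∃ K, 0 ≤ K ∧ ∀ (δ : ℝ), 0 < δ → δ ≤ 1 → ∀ (n : ℕ) (X : Fin n → EuclideanSpace ℝ (Fin d))
      (R : ℝ), (∀ i j, i ≠ j → δ ≤ ‖X i - X j‖) → (∀ i, ‖X i‖ ≤ R) →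
      ∀ (c : Fin n → ℝ) (B : ℝ), 0 ≤ B → (∀ i, |c i| ≤ B) →
      ∃ g : EuclideanSpace ℝ (Fin d) → ℝ, ContDiff ℝ ∞ g ∧ SupportedInBall (R + 1) g ∧
        (∀ i, g (X i) = c i) ∧
        ∀ L : List (Fin d), L.length ≤ r → ∀ x, |listDeriv L g x| ≤ K * B * δ⁻¹ ^ L.length := by
  -- An outer radius below `1/2` makes the bumps rescaled to `δ`-separated centres disjoint.
  let φ : ContDiffBump (0 : EuclideanSpace ℝ (Fin d)) := ⟨1 / 4, 1 / 3, by norm_num, by norm_num⟩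
  have hφ : ContDiff ℝ ∞ φ := φ.contDiff
  have hφs : SupportedInBall (1 / 3) φ := fun x hx =>
    φ.zero_of_le_dist (by simpa [φ] using hx.le)
  have hφ1 : φ 0 = 1 := φ.one_of_mem_closedBall (by simp [φ])
  obtain ⟨K, hK0, hK⟩ := exists_derivBound (m := r)
    (hφ.of_le (by exact_mod_cast le_top)) hφs
  refine ⟨K, hK0, fun δ hδ hδ1 n X R hX hXR c B hB hc => ?_⟩
  have hnorm : ∀ y : EuclideanSpace ℝ (Fin d), ‖δ⁻¹ • y‖ ≤ 1 / 3 → ‖y‖ ≤ δ / 3 := by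
    intro y hy
    rw [norm_smul, Real.norm_eq_abs, abs_of_pos (inv_pos.2 hδ), inv_mul_eq_div,
      div_le_iff₀ hδ] at hy
    linarith
  have hfar : ∀ (u : EuclideanSpace ℝ (Fin d) → ℝ), SupportedInBall (1 / 3) u → ∀ i x,
      u (δ⁻¹ • (x - X i)) ≠ 0 → ‖x - X i‖ ≤ δ / 3 := by
    intro u hu i x hne
    exact hnorm _ (not_lt.1 fun hlt => hne (hu _ hlt))
  have hterm : ∀ i, ContDiff ℝ ∞ fun x => φ (δ⁻¹ • (x - X i)) := fun i =>
    hφ.comp (by fun_prop)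
  have hcd : ∀ i, ContDiff ℝ ∞ fun x => c i * φ (δ⁻¹ • (x - X i)) := fun i =>
    contDiff_const.mul (hterm i)
  refine ⟨fun x => ∑ i, c i * φ (δ⁻¹ • (x - X i)), ContDiff.sum fun i _ => hcd i, ?_, ?_, ?_⟩
  · intro x hx
    refine Finset.sum_eq_zero fun i _ => ?_
    by_contra hne
    have h1 := hfar φ hφs i x (right_ne_zero_of_mul hne)
    have h2 := norm_le_norm_add_norm_sub' x (X i)
    linarith [hXR i]
  · intro j
    beta_reduce
    rw [Finset.sum_eq_single j]
    · simp [hφ1]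
    · intro i _ hij
      by_contra hne
      have h1 := hfar φ hφs i (X j) (right_ne_zero_of_mul hne)
      linarith [hX j i hij.symm]
    · simp
  · intro L hL x
    rw [listDeriv_sum _ _ _ fun i _ => (hcd i).of_le (by exact_mod_cast le_top)]
    have heq : ∀ i, listDeriv L (fun x => c i * φ (δ⁻¹ • (x - X i))) x =
        c i * (δ⁻¹ ^ L.length * listDeriv L φ (δ⁻¹ • (x - X i))) := by
      intro i
      rw [listDeriv_const_mul (h := fun x => φ (δ⁻¹ • (x - X i))) L _
          ((hterm i).of_le (by exact_mod_cast le_top)),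
        listDeriv_comp_smul_sub L _ _ (hφ.of_le (by exact_mod_cast le_top))]
    simp only [heq]
    have hbound : ∀ i, |c i * (δ⁻¹ ^ L.length * listDeriv L φ (δ⁻¹ • (x - X i)))| ≤
        K * B * δ⁻¹ ^ L.length := by
      intro i
      have hp : 0 ≤ δ⁻¹ ^ L.length := by positivity
      rw [abs_mul, abs_mul, abs_of_nonneg hp]
      calc _ ≤ B * (δ⁻¹ ^ L.length * K) := by
            gcongr
            · exact hc i
            · exact hK L hL _
        _ = _ := by ring
    -- At most one bump is active at `x`, so the bound does not depend on `n`.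
    by_cases hex : ∃ i, listDeriv L φ (δ⁻¹ • (x - X i)) ≠ 0
    · obtain ⟨i, hi⟩ := hex
      rw [Finset.sum_eq_single i]
      · exact hbound i
      · intro j _ hji
        by_contra hne
        have h1 := hfar _ (hφs.listDeriv L) i x hi
        have h2 := hfar _ (hφs.listDeriv L) j x
          (right_ne_zero_of_mul (right_ne_zero_of_mul hne))
        have h3 := norm_sub_le_norm_sub_add_norm_sub (X j) x (X i)
        rw [norm_sub_rev (X j) x] at h3
        linarith [hX j i hji]
      · simp
    · push Not at hex
      simp only [hex, mul_zero, Finset.sum_const_zero, abs_zero]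
      positivity

/-- A compactly supported `C^s` function agrees at `δ`-separated points with a smooth function
that is uniformly `O(δ^s)`-close and has derivatives up to order `r` of size `O(δ^{s - r})`. -/
lemma exists_smooth_approx_interpolant {s r : ℕ} (hsr : s ≤ r) (hh : ContDiff ℝ s h)
    (hsupp : SupportedInBall R h) :
    ∃ A, 0 ≤ A ∧ ∀ (δ : ℝ), 0 < δ → δ ≤ 1 →
      ∀ (n : ℕ) (X : Fin n → EuclideanSpace ℝ (Fin d)),
      (∀ i j, i ≠ j → δ ≤ ‖X i - X j‖) → (∀ i, ‖X i‖ ≤ R) →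
      ∃ g : EuclideanSpace ℝ (Fin d) → ℝ, ContDiff ℝ ∞ g ∧ SupportedInBall (R + s + 1) g ∧
        (∀ i, g (X i) = h (X i)) ∧ (∀ x, |h x - g x| ≤ A * δ ^ s) ∧
        DerivBound r (A * δ⁻¹ ^ (r - s)) g := by
  obtain ⟨A, hA0, hA⟩ := exists_smooth_approx s r hh hsupp
  obtain ⟨K, hK0, hK⟩ := exists_smooth_interpolant d r
  refine ⟨A + K * A, by positivity, fun δ hδ hδ1 n X hX hXR => ?_⟩
  obtain ⟨g₁, hg₁, hg₁s, hg₁e, hg₁b⟩ := hA δ hδ hδ1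
  -- `g₂` interpolates the defect of `g₁`, which has size `A * δ ^ s`.
  obtain ⟨g₂, hg₂, hg₂s, hg₂X, hg₂b⟩ := hK δ hδ hδ1 n X R hX hXR
    (fun i => h (X i) - g₁ (X i)) (A * δ ^ s) (by positivity) fun i => hg₁e _
  have hsum : (fun x => g₁ x + g₂ x) = fun x => ∑ j : Fin 2, ![g₁, g₂] j x := by
    ext x; simp
  refine ⟨fun x => g₁ x + g₂ x, hg₁.add hg₂, ?_, ?_, ?_, ?_⟩
  · intro x hx
    have hs : (0 : ℝ) ≤ s := by positivity
    simp only [hg₁s x (by linarith), hg₂s x (by linarith), add_zero]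
  · intro i
    simp [hg₂X i]
  · intro x
    have h1 := hg₁e x
    have h2 := hg₂b [] (Nat.zero_le _) x
    simp only [listDeriv_nil, List.length_nil, pow_zero, mul_one] at h2
    rw [← sub_sub]
    refine (abs_sub _ _).trans ((add_le_add h1 h2).trans (le_of_eq ?_))
    ring
  · intro L hL x
    rw [hsum, listDeriv_sum]
    · simp only [Fin.sum_univ_two, Matrix.cons_val_zero, Matrix.cons_val_one]
      have hpow : δ ^ s * δ⁻¹ ^ L.length ≤ δ⁻¹ ^ (r - s) := by
        have hδ' : 1 ≤ δ⁻¹ := (one_le_inv₀ hδ).2 hδ1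
        calc δ ^ s * δ⁻¹ ^ L.length ≤ δ ^ s * δ⁻¹ ^ r := by gcongr
          _ = δ ^ s * (δ⁻¹ ^ s * δ⁻¹ ^ (r - s)) := by rw [← pow_add, Nat.add_sub_cancel' hsr]
          _ = δ⁻¹ ^ (r - s) := by
              rw [← mul_assoc, ← mul_pow, mul_inv_cancel₀ hδ.ne', one_pow, one_mul]
      refine (abs_add_le _ _).trans ?_
      rw [add_mul]
      refine add_le_add (hg₁b L hL x) ((hg₂b L hL x).trans ?_)
      calc K * (A * δ ^ s) * δ⁻¹ ^ L.length = K * A * (δ ^ s * δ⁻¹ ^ L.length) := by ring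
        _ ≤ _ := by gcongr
    · intro j _
      fin_cases j
      · exact hg₁.of_le (by exact_mod_cast le_top)
      · exact hg₂.of_le (by exact_mod_cast le_top)

end Approximation

/-! ### Consequences of the worst-case error rate. -/

section Quadrature

variable {d r : ℕ} {P : Measure (EuclideanSpace ℝ (Fin d))}
  {w : (n : ℕ) → Fin n → ℝ} {X : (n : ℕ) → Fin n → EuclideanSpace ℝ (Fin d)} {b : ℝ}

/-- The worst-case error rate yields the same rate, uniformly, for smooth functions supported in a
fixed ball, scaled by a bound on their derivatives. -/
lemma exists_quadrature_error_le
    (he : ∃ K : ℝ, ∀ᶠ n : ℕ in atTop,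
      worstCaseError P r (w n) (X n) ≤ ENNReal.ofReal (K * (n : ℝ) ^ (-b))) (R : ℝ) :
    ∃ K, 0 ≤ K ∧ ∀ᶠ n : ℕ in atTop, ∀ (g : EuclideanSpace ℝ (Fin d) → ℝ) (A : ℝ), 0 ≤ A →
      ContDiff ℝ ∞ g → SupportedInBall R g → DerivBound r A g →
      |(∫ x, g x ∂P) - quadSum (w n) (X n) g| ≤ K * A * (n : ℝ) ^ (-b) := by
  obtain ⟨K, hK⟩ := he
  obtain ⟨K₁, hK₁0, hK₁⟩ := exists_normW2_le d r R
  refine ⟨K₁ * |K|, by positivity, hK.mono fun n hn g A hA hg hgs hgb => ?_⟩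
  -- The case `A = 0` is separate because `g` is normalized by `K₁ * A`.
  rcases hA.eq_or_lt with rfl | hA
  · have hg0 : g = 0 := by
      ext x
      simpa using hgb [] (Nat.zero_le _) x
    simp [hg0, quadSum]
  set c := K₁ * A
  have hc : 0 < c := mul_pos hK₁0 hA
  have hg' : ContDiff ℝ ∞ fun x => c⁻¹ * g x := contDiff_const.mul hg
  have hgs' : SupportedInBall R fun x => c⁻¹ * g x := fun x hx => by
    simp only [hgs x hx, mul_zero]
  have hgb' : DerivBound r (c⁻¹ * A) fun x => c⁻¹ * g x := by
    intro L hL x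
    rw [listDeriv_const_mul L _ (hg.of_le (by exact_mod_cast le_top)), abs_mul,
      abs_of_pos (inv_pos.2 hc)]
    exact mul_le_mul_of_nonneg_left (hgb L hL x) (inv_pos.2 hc).le
  have hnorm : normW2 r (fun x => c⁻¹ * g x) ≤ 1 := by
    refine (hK₁ _ _ (by positivity) hg' hgs' hgb').trans (le_of_eq ?_)
    rw [mul_left_comm]
    exact inv_mul_cancel₀ hc.ne'
  have hle : ENNReal.ofReal |(∫ x, c⁻¹ * g x ∂P) - quadSum (w n) (X n) fun x => c⁻¹ * g x| ≤
      ENNReal.ofReal (|K| * (n : ℝ) ^ (-b)) := by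
    refine (le_iSup₂_of_le (f := fun (g : EuclideanSpace ℝ (Fin d) → ℝ)
      (_ : Continuous g ∧ MemW2 r g ∧ normW2 r g ≤ 1) =>
        ENNReal.ofReal |(∫ x, g x ∂P) - quadSum (w n) (X n) g|) (fun x => c⁻¹ * g x)
      ⟨hg'.continuous, memW2_of_contDiff r hg' hgs', hnorm⟩ le_rfl).trans (hn.trans ?_)
    gcongr
    exact le_abs_self K
  rw [ENNReal.ofReal_le_ofReal_iff (by positivity)] at hle
  have heq : (∫ x, c⁻¹ * g x ∂P) - quadSum (w n) (X n) (fun x => c⁻¹ * g x) =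
      c⁻¹ * ((∫ x, g x ∂P) - quadSum (w n) (X n) g) := by
    rw [integral_const_mul, mul_sub, quadSum, quadSum, Finset.mul_sum]
    congr 1
    exact Finset.sum_congr rfl fun i _ => by ring
  rw [heq, abs_mul, abs_of_pos (inv_pos.2 hc), inv_mul_le_iff₀ hc] at hle
  refine hle.trans (le_of_eq ?_)
  ring

lemma tendsto_quadSum (hb : 0 < b)
    (he : ∃ K : ℝ, ∀ᶠ n : ℕ in atTop,
      worstCaseError P r (w n) (X n) ≤ ENNReal.ofReal (K * (n : ℝ) ^ (-b)))
    {R : ℝ} {g : EuclideanSpace ℝ (Fin d) → ℝ} (hg : ContDiff ℝ ∞ g)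
    (hgs : SupportedInBall R g) :
    Tendsto (fun n => quadSum (w n) (X n) g) atTop (𝓝 (∫ x, g x ∂P)) := by
  obtain ⟨K, -, hK⟩ := exists_quadrature_error_le he R
  obtain ⟨A, hA0, hA⟩ := exists_derivBound (m := r) (hg.of_le (by exact_mod_cast le_top)) hgs
  have hlim : Tendsto (fun n : ℕ => K * A * (n : ℝ) ^ (-b)) atTop (𝓝 0) := by
    simpa using ((tendsto_rpow_neg_atTop hb).comp tendsto_natCast_atTop_atTop).const_mul (K * A)
  rw [tendsto_iff_dist_tendsto_zero]
  refine squeeze_zero' (Eventually.of_forall fun _ => dist_nonneg) (hK.mono fun n hn => ?_) hlim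
  rw [dist_comm, Real.dist_eq]
  exact hn g A hA0 hg hgs hA

/-- If the worst-case error tends to zero and the point sets have diameter at most one, then the
points eventually stay in a fixed ball, which carries all the mass of `P`. -/
lemma exists_ball_of_worstCaseError [IsProbabilityMeasure P] (hb : 0 < b)
    (he : ∃ K : ℝ, ∀ᶠ n : ℕ in atTop,
      worstCaseError P r (w n) (X n) ≤ ENNReal.ofReal (K * (n : ℝ) ^ (-b)))
    (hdiam : ∀ n : ℕ, 1 ≤ n → Metric.diam (Set.range (X n)) ≤ 1) :
    ∃ R : ℝ, 0 ≤ R ∧ (∀ᶠ n in atTop, ∀ i, ‖X n i‖ ≤ R) ∧ ∀ᵐ x ∂P, ‖x‖ ≤ R := by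
  obtain ⟨m, hm⟩ : ∃ m : ℕ, P (Metric.closedBall 0 m) ≠ 0 := by
    by_contra hcon
    push Not at hcon
    have := measure_iUnion_null hcon
    rw [Metric.iUnion_closedBall_nat, measure_univ] at this
    exact one_ne_zero this
  have hm0 : (0 : ℝ) ≤ m := by positivity
  let χ : ContDiffBump (0 : EuclideanSpace ℝ (Fin d)) :=
    ⟨m + 1, m + 2, by positivity, by linarith⟩
  have hχs : SupportedInBall (m + 2) χ := fun x hx =>
    χ.zero_of_le_dist (by simpa [χ] using hx.le)
  have hχpos : 0 < ∫ x, χ x ∂P := by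
    rw [integral_pos_iff_support_of_nonneg (fun x => χ.nonneg)
      (χ.continuous.integrable_of_hasCompactSupport χ.hasCompactSupport), χ.support_eq]
    refine (pos_iff_ne_zero.2 hm).trans_le (measure_mono (Metric.closedBall_subset_ball ?_))
    simp [χ]
  -- Since `P_n χ → P χ > 0`, some point eventually lies in the support of `χ`; the diameter bound
  -- then catches all the others.
  have hpts : ∀ᶠ n in atTop, ∀ i, ‖X n i‖ ≤ m + 3 := by
    filter_upwards [(tendsto_quadSum hb he χ.contDiff hχs).eventually_ne hχpos.ne'] with n hn j
    obtain ⟨i, -, hi⟩ := Finset.exists_ne_zero_of_sum_ne_zero hn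
    have hXi : ‖X n i‖ ≤ m + 2 := not_lt.1 fun hlt => right_ne_zero_of_mul hi (hχs _ hlt)
    have hdist : dist (X n j) (X n i) ≤ 1 :=
      (Metric.dist_le_diam_of_mem (Set.finite_range _).isBounded ⟨j, rfl⟩ ⟨i, rfl⟩).trans
        (hdiam n i.pos)
    rw [dist_eq_norm] at hdist
    linarith [norm_le_norm_add_norm_sub' (X n j) (X n i)]
  refine ⟨m + 4, by positivity, hpts.mono fun n hn i => (hn i).trans (by linarith), ?_⟩
  let ψ : ContDiffBump (0 : EuclideanSpace ℝ (Fin d)) :=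
    ⟨m + 3, m + 4, by positivity, by linarith⟩
  let ξ : ℕ → ContDiffBump (0 : EuclideanSpace ℝ (Fin d)) := fun k =>
    ⟨k + 1, k + 2, by positivity, by linarith⟩
  -- The test function vanishes at all the points for large `n`, so its quadrature sums, and hence
  -- its `P`-integral, are zero. These supports cover everything outside radius `m + 4`.
  have hnull : ∀ k, P (Function.support fun x => ξ k x * (1 - ψ x)) = 0 := by
    intro k
    have hξs : SupportedInBall (k + 2) fun x => ξ k x * (1 - ψ x) := fun x hx => by
      simp only [(ξ k).zero_of_le_dist (by simpa [ξ] using hx.le), zero_mul]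
    have hsm : ContDiff ℝ ∞ fun x => ξ k x * (1 - ψ x) :=
      (ξ k).contDiff.mul (contDiff_const.sub ψ.contDiff)
    have hzero : ∀ᶠ n in atTop, quadSum (w n) (X n) (fun x => ξ k x * (1 - ψ x)) = 0 := by
      filter_upwards [hpts] with n hn
      refine Finset.sum_eq_zero fun i _ => ?_
      beta_reduce
      rw [ψ.one_of_mem_closedBall (by simpa [ψ] using hn i)]
      ring
    have hint : ∫ x, ξ k x * (1 - ψ x) ∂P = 0 :=
      tendsto_nhds_unique (tendsto_quadSum hb he hsm hξs)
        (tendsto_const_nhds.congr' (hzero.mono fun n hn => hn.symm))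
    rw [integral_eq_zero_iff_of_nonneg
      (fun x => mul_nonneg (ξ k).nonneg (sub_nonneg.2 ψ.le_one))
      (hsm.continuous.integrable_of_hasCompactSupport hξs.hasCompactSupport)] at hint
    exact hint
  refine measure_mono_null (fun x hx => ?_) (measure_iUnion_null hnull)
  have hx : (m : ℝ) + 4 < ‖x‖ := not_le.1 hx
  obtain ⟨k, hk⟩ := exists_nat_ge ‖x‖
  refine Set.mem_iUnion.2 ⟨k, ?_⟩
  have h1 : ψ x = 0 := ψ.zero_of_le_dist (by simpa [ψ] using hx.le)
  have h2 : 0 < ξ k x := (ξ k).pos_of_mem_ball (by simp [ξ]; linarith)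
  simp [h1, h2.ne']

lemma le_norm_sub_of_le_separationRadius {n : ℕ} {Y : Fin n → EuclideanSpace ℝ (Fin d)} {q : ℝ}
    (hq : ENNReal.ofReal q ≤ separationRadius Y) {i j : Fin n} (hij : i ≠ j) :
    q ≤ ‖Y i - Y j‖ := by
  refine (ENNReal.ofReal_le_ofReal_iff (norm_nonneg _)).1 (hq.trans ?_)
  exact (iInf_le _ i).trans ((iInf_le _ j).trans (iInf_le _ hij))

end Quadrature

/-! ### The convergence rate. -/

theorem theorem3
    (d r : ℕ) (hr : (d : ℝ) / 2 < r)
    (P : Measure (EuclideanSpace ℝ (Fin d))) [IsProbabilityMeasure P]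
    (w : (n : ℕ) → Fin n → ℝ) (X : (n : ℕ) → Fin n → EuclideanSpace ℝ (Fin d))
    (b : ℝ) (hb : 0 < b)
    (he : ∃ K : ℝ, ∀ᶠ n : ℕ in atTop,
      worstCaseError P r (w n) (X n) ≤ ENNReal.ofReal (K * (n : ℝ) ^ (-b)))
    (hq : ∃ C : ℝ, 0 < C ∧ ∀ n : ℕ, 1 ≤ n →
      ENNReal.ofReal (C * (n : ℝ) ^ (-(b / r))) ≤ separationRadius (X n))
    (hdiam : ∀ n : ℕ, 1 ≤ n → Metric.diam (Set.range (X n)) ≤ 1)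
    (s : ℕ) (hs : s ≤ r)
    (f : EuclideanSpace ℝ (Fin d) → ℝ) (hfC : MemC0 s f) (hfW : MemW2 s f) :
    (fun n : ℕ => |quadSum (w n) (X n) f - ∫ x, f x ∂P|)
      =O[atTop] (fun n : ℕ => (n : ℝ) ^ (-(b * s / r))) := by
  have hr0 : (0 : ℝ) < r := lt_of_le_of_lt (by positivity) hr
  obtain ⟨R, hR0, hXR, hPR⟩ := exists_ball_of_worstCaseError hb he hdiam
  obtain ⟨C, hC, hsep⟩ := hq
  let χ : ContDiffBump (0 : EuclideanSpace ℝ (Fin d)) :=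
    ⟨R + 1, R + 2, by positivity, by linarith⟩
  have hχ1 : ∀ x, ‖x‖ ≤ R → χ x = 1 := fun x hx =>
    χ.one_of_mem_closedBall (by simp [χ]; linarith)
  set h : EuclideanSpace ℝ (Fin d) → ℝ := fun x => χ x * f x
  have hh : ContDiff ℝ s h := χ.contDiff.mul hfC.1
  have hhs : SupportedInBall (R + 2) h := fun x hx => by
    simp only [h, χ.zero_of_le_dist (by simpa [χ] using hx.le), zero_mul]
  have hfh : ∀ x, ‖x‖ ≤ R → f x = h x := fun x hx => by simp [h, hχ1 x hx]
  have hPf : ∫ x, f x ∂P = ∫ x, h x ∂P := integral_congr_ae (hPR.mono hfh)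
  have hhi : Integrable h P :=
    hh.continuous.integrable_of_hasCompactSupport hhs.hasCompactSupport
  obtain ⟨A, hA0, hA⟩ := exists_smooth_approx_interpolant hs hh hhs
  obtain ⟨K, hK0, hK⟩ := exists_quadrature_error_le he (R + 2 + s + 1)
  -- The minimum gives both `δ`-separation and `δ ≤ 1`.
  set c : ℝ := min C 1
  have hc : 0 < c := lt_min hC one_pos
  refine IsBigO.of_bound (K * (A * c⁻¹ ^ (r - s)) + A * c ^ s) ?_
  filter_upwards [hXR, hK, eventually_ge_atTop 1] with n hXn hKn hn1
  have hn : (0 : ℝ) < n := by exact_mod_cast hn1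
  set δ : ℝ := c * (n : ℝ) ^ (-(b / r))
  have hδ : 0 < δ := by positivity
  have hδ1 : δ ≤ 1 := mul_le_one₀ (min_le_right _ _) (by positivity)
    (Real.rpow_le_one_of_one_le_of_nonpos (by exact_mod_cast hn1)
      (neg_nonpos.2 (by positivity)))
  have hδsep : ∀ i j, i ≠ j → δ ≤ ‖X n i - X n j‖ := fun i j hij =>
    (mul_le_mul_of_nonneg_right (min_le_left C 1) (by positivity)).trans
      (le_norm_sub_of_le_separationRadius (hsep n hn1) hij)
  obtain ⟨g, hg, hgs, hgX, hge, hgb⟩ := hA δ hδ hδ1 n (X n) hδsep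
    fun i => (hXn i).trans (by linarith)
  have hgi : Integrable g P :=
    hg.continuous.integrable_of_hasCompactSupport hgs.hasCompactSupport
  have hquad : quadSum (w n) (X n) f = quadSum (w n) (X n) g :=
    Finset.sum_congr rfl fun i _ => by rw [hgX, hfh _ (hXn i)]
  have h1 := hKn g _ (by positivity) hg hgs hgb
  have h2 : |(∫ x, h x ∂P) - ∫ x, g x ∂P| ≤ A * δ ^ s := by
    rw [← integral_sub hhi hgi]
    have := norm_integral_le_of_norm_le_const (μ := P) (f := fun x => h x - g x)
      (Eventually.of_forall hge)
    simpa using this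
  have hδs : δ ^ s = c ^ s * (n : ℝ) ^ (-(b * s / r)) := by
    rw [mul_pow, ← Real.rpow_mul_natCast hn.le]
    congr 2
    ring
  -- The exponents balance: `(b/r)(r - s) - b = -bs/r`.
  have hδrs : δ⁻¹ ^ (r - s) * (n : ℝ) ^ (-b) =
      c⁻¹ ^ (r - s) * (n : ℝ) ^ (-(b * s / r)) := by
    rw [mul_inv, ← Real.rpow_neg hn.le, neg_neg, mul_pow, ← Real.rpow_mul_natCast hn.le,
      mul_assoc, ← Real.rpow_add hn, Nat.cast_sub hs]
    congr 2
    field_simp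
    ring
  rw [hquad, hPf, Real.norm_eq_abs, abs_abs, Real.norm_eq_abs,
    abs_of_pos (Real.rpow_pos_of_pos hn _), abs_sub_comm]
  calc |(∫ x, h x ∂P) - quadSum (w n) (X n) g|
      ≤ |(∫ x, h x ∂P) - ∫ x, g x ∂P| + |(∫ x, g x ∂P) - quadSum (w n) (X n) g| :=
        abs_sub_le _ _ _
    _ ≤ A * δ ^ s + K * (A * δ⁻¹ ^ (r - s)) * (n : ℝ) ^ (-b) := add_le_add h2 h1
    _ = A * δ ^ s + K * A * (δ⁻¹ ^ (r - s) * (n : ℝ) ^ (-b)) := by ring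
    _ = _ := by rw [hδrs, hδs]; ring
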